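/- Let $G=(V,E)$ be a finite simple graph and $k\ge 0$ an integer. A $k$-rainbow dominating function on $G$ is a map $f\colon V\to 2^{\{1,\dots,k\}}$ such that $\bigcup_{u\sim v} f(u)=\{1,\dots,k\}$ for every vertex $v$ with $f(v)=\emptyset$. Its weight is $w(f)=\sum_{v\in V}|f(v)|$, and the $k$-rainbow domination number $\gamma_{rk}(G)$ is the minimum weight of a $k$-rainbow dominating function on $G$. For $m\ge 2$, the Möbius ladder $\mathrm{Ml}(m)$ is the graph of order $2m$ with vertices $u_0,\dots,u_{m-1},v_0,\dots,v_{m-1}$ and edges $\{u_i,v_i\}$ for $0\le i\le m-1$, $\{u_i,u_{i+1}\}$ and $\{v_i,v_{i+1}\}$ for $0\le i\le m-2$, together with $\{u_{m-1},v_0\}$ and $\{v_{m-1},u_0\}$. **Theorem.** Let $m\ge 2$ and $G=\mathrm{Ml}(m)$. Then - $\gamma_{r1}(G)=\lceil m/2\rceil+\begin{cases}1,& m\equiv 0\pmod 4,\\ 0,& m\equiv 1,2,3\pmod 4;\end{cases}$ - $\gamma_{r2}(G)=m$; - $\gamma_{r3}(G)=m+\begin{cases}0,& m\equiv 3\pmod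 6,\\ 1,& m\equiv 0,2,4,5\pmod 6,\\ 2,& m\equiv 1\pmod 6;\end{cases}$ - $\gamma_{r4}(G)=\lceil 4m/3\rceil+\begin{cases}0,& m\equiv 3,4\pmod 6,\\ 1,& m\equiv 0,1,2,5\pmod 6;\end{cases}$ - $\gamma_{r5}(G)=\lceil 5m/3\rceil+\begin{cases}0,& m\equiv 2,3,4,5\pmod 6,\\ 1,& m\equiv 0,1\pmod 6;\end{cases}$ - $\gamma_{rk}(G)=2m$ for all $k\ge 6$. Moreover, for $m\equiv 3\pmod 6$ and $3\le k\le 6$, one has $\gamma_{rk}(G)=km/3$, that is, the lower bound $\gamma_{rk}\geq kn/(2d)$ for $d$-regular graphs of order $n$ is attained (here $d=3$, $n=2m$). For $m\equiv 3\pmod 6$ and $k=3,4,5$, a $k$-rainbow dominating function of weight $\gamma_{rk}(G)$ is given by $$f(u_i)=\{3,\dots,k\},\{1\},\{2\}\ \text{ for } i\equiv 1,3,5\pmod 6,\qquad f(v_i)=\{1\},\{2\},\{3,\dots,k\}\ \text{ for } i\equiv 0,2,4\pmod 6,$$ and $f=\emptyset$ on all other vertices. -/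

import Mathlib

/-- `f : V → 2^C`, with colour set `C = Fin k` (`k` colours), is a `k`-rainbow dominating function
on `G`: the colours found on the neighbours of any non-coloured vertex make up all of `C`. -/
def IsRainbowDominating {V : Type*} (G : SimpleGraph V) (k : ℕ) (f : V → Finset (Fin k)) : Prop :=
  ∀ v : V, f v = ∅ → (⋃ u ∈ G.neighborSet v, (f u : Set (Fin k))) = Set.univ

/-- The weight `w(f) = ∑ v, |f v|`. -/
def rainbowWeight {V : Type*} [Fintype V] {k : ℕ} (f : V → Finset (Fin k)) : ℕ :=
  ∑ v : V, (f v).card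

/-- The `k`-rainbow domination number: the minimal weight of a `k`-rainbow dominating function
(the minimum exists, see `isLeast_rainbowDominationNumber`). -/
noncomputable def rainbowDominationNumber {V : Type*} [Fintype V] (G : SimpleGraph V) (k : ℕ) : ℕ :=
  sInf {w : ℕ | ∃ f : V → Finset (Fin k), IsRainbowDominating G k f ∧ rainbowWeight f = w}

theorem isLeast_rainbowDominationNumber {V : Type*} [Fintype V] (G : SimpleGraph V) (k : ℕ) :
    IsLeast {w : ℕ | ∃ f : V → Finset (Fin k), IsRainbowDominating G k f ∧ rainbowWeight f = w}
      (rainbowDominationNumber G k) := by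
  refine ⟨Nat.sInf_mem ⟨_, fun _ => Finset.univ, ?_, rfl⟩, fun w hw => Nat.sInf_le hw⟩
  intro v hv
  ext c
  exact absurd (Finset.mem_univ c) (by simp [hv])

/-- The Möbius ladder `Ml(m)` with vertices `u_i = (i, false)` and `v_i = (i, true)`,
`0 ≤ i ≤ m - 1`, and edges `{u_i, v_i}` for all `i`, `{u_i, u_{i+1}}` and `{v_i, v_{i+1}}` for
`i ≠ m - 1`, and the two edges `{u_{m-1}, v_0}` and `{v_{m-1}, u_0}`. -/
def mobiusLadder (m : ℕ) : SimpleGraph (Fin m × Bool) :=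
  SimpleGraph.fromRel fun a b =>
    (a.1 = b.1 ∧ a.2 ≠ b.2) ∨
    (a.1.val + 1 = b.1.val ∧ a.2 = b.2) ∨
    (a.1.val + 1 = m ∧ b.1.val = 0 ∧ a.2 ≠ b.2)

/-- The explicit colouring, periodic along the ladder with period six,
`u : ∅ A ∅ 1 ∅ 2 ∅ A ∅ ...` and `v : 1 ∅ 2 ∅ A ∅ 1 ∅ 2 ...`, where `A = {3, ..., k}`
(the colours `1, 2, 3, ..., k` are the elements of `Fin k` with values `0, 1, 2, ..., k - 1`). -/
def mobiusColoring (m k : ℕ) (p : Fin m × Bool) : Finset (Fin k) :=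
  Finset.univ.filter fun c : Fin k =>
    (p.2 = false ∧
      ((p.1.val % 6 = 1 ∧ 2 ≤ c.val) ∨ (p.1.val % 6 = 3 ∧ c.val = 0) ∨
        (p.1.val % 6 = 5 ∧ c.val = 1))) ∨
    (p.2 = true ∧
      ((p.1.val % 6 = 0 ∧ c.val = 0) ∨ (p.1.val % 6 = 2 ∧ c.val = 1) ∨
        (p.1.val % 6 = 4 ∧ 2 ≤ c.val)))

/-!
The Möbius ladder `Ml(m)` is the circulant graph on `ℤ/2m` in which `x` is adjacent to `x - 1`,
`x + 1` and `x + m` (`ladderToCirculant_of_adj`), so sums over vertices are translation invariant.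

**Lower bounds, `k ≥ 3`.** Let `w` be the weight, `N` the number of coloured vertices, `S` the total
excess of the colours seen by empty vertices over `k`, and `Q` the sum of the weights of the
coloured vertices over their coloured neighbours. Counting over neighbourhoods gives
`3w = S + k(2m - N) + Q` (`Circulant.three_mul_weight`). Counting edges gives `6(N - m) = M - M'`
(`Circulant.six_mul_numColored_sub`), where `M ≤ Q` and `M'` are twice the numbers of edges between
coloured and between empty vertices. Moreover each single colour must occur on at least a third as
many vertices as there are empty ones, so `w ≥ k⌈(2m - N)/3⌉` (`Circulant.mul_le_weight`). If
`N ≤ m`, this last bound suffices, with one exception; if `N > m`, the two identities and `w ≥ N`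
suffice, with another. The first exception has no edges inside the two classes, so that the graph
would be bipartite, and is impossible for even `m` (`Circulant.not_even_of_edges_eq_zero`). The
second has `N = m + 1`, no edge between empty vertices and no excess; there the colour sets along
the ladder are forced to have period three, which is impossible for `m ≡ 1 (mod 6)`
(`Circulant.not_mod_three_eq_one`).

**Lower bounds, `k ≤ 2`.** For `k = 2` a rung without colours can be paid for by its two
neighbouring rungs (`Circulant.le_weight_two`). For `k = 1` the bound is the one by closed
neighbourhoods, and a perfect code is excluded for `4 ∣ m` since it would be invariant under
translation by `4` (`Circulant.four_mul_weight_ne`).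

**Upper bounds.** Colourings are written as words of columns. A period that may be repeated can be
inserted in front of any dominating word that begins with the first two columns of the period
(`Column.IsMobius.pump`), so one word for each residue of `m` suffices.
-/

/-! ### Weight identities on the circulant graph -/

/-- `k`-rainbow domination on the circulant graph with vertex set `ℤ/2m`, in which the neighbours
of `x` are `x - 1`, `x + 1` and `x + m`. -/
def IsCirculantDominating (m : ℕ) {k : ℕ} (g : ZMod (2 * m) → Finset (Fin k)) : Prop :=
  ∀ x, g x = ∅ → g (x - 1) ∪ g (x + 1) ∪ g (x + m) = Finset.univ

namespace Circulant

variable {m k : ℕ} (g : ZMod (2 * m) → Finset (Fin k))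

/-- The number of colours at `x`. -/
def wt (x : ZMod (2 * m)) : ℤ := (g x).card

/-- The indicator of the coloured vertices. -/
def ind (x : ZMod (2 * m)) : ℤ := if g x = ∅ then 0 else 1

/-- The sum of a function over the three neighbours of `x`. -/
def nbrSum (a : ZMod (2 * m) → ℤ) (x : ZMod (2 * m)) : ℤ := a (x - 1) + a (x + 1) + a (x + m)

lemma ind_le_wt (x : ZMod (2 * m)) : ind g x ≤ wt g x := by
  unfold ind wt
  split_ifs with h
  · positivity
  · have := Finset.card_pos.2 (Finset.nonempty_iff_ne_empty.2 h)
    omega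

lemma ind_nonneg (x : ZMod (2 * m)) : 0 ≤ ind g x := by
  unfold ind; split_ifs <;> simp

lemma ind_le_one (x : ZMod (2 * m)) : ind g x ≤ 1 := by
  unfold ind; split_ifs <;> simp

variable {g}

lemma le_nbrSum_of_eq_empty (hg : IsCirculantDominating m g) {x : ZMod (2 * m)} (hx : g x = ∅) :
    (k : ℤ) ≤ nbrSum (wt g) x := by
  have h := congrArg Finset.card (hg x hx)
  have h1 := Finset.card_union_le (g (x - 1) ∪ g (x + 1)) (g (x + m))
  have h2 := Finset.card_union_le (g (x - 1)) (g (x + 1))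
  rw [Finset.card_univ, Fintype.card_fin] at h
  unfold nbrSum wt
  omega

variable [NeZero m]

lemma sum_nbrSum (a : ZMod (2 * m) → ℤ) : ∑ x, nbrSum a x = 3 * ∑ x, a x := by
  unfold nbrSum
  have h1 : ∑ x, a (x - 1) = ∑ x, a x := Equiv.sum_comp (Equiv.subRight (1 : ZMod (2 * m))) a
  have h2 : ∑ x, a (x + 1) = ∑ x, a x := Equiv.sum_comp (Equiv.addRight (1 : ZMod (2 * m))) a
  have h3 : ∑ x, a (x + m) = ∑ x, a x := Equiv.sum_comp (Equiv.addRight (m : ZMod (2 * m))) a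
  rw [Finset.sum_add_distrib, Finset.sum_add_distrib, h1, h2, h3]
  ring

lemma sum_one : ∑ _x : ZMod (2 * m), (1 : ℤ) = 2 * m := by simp [ZMod.card]

variable (g)

/-- The number of coloured vertices. -/
def numColored : ℤ := ∑ x, ind g x

/-- The total weight. -/
def weight : ℤ := ∑ x, wt g x

/-- The total excess of the colours seen by the empty vertices over the required `k`. -/
def excess : ℤ := ∑ x, (1 - ind g x) * (nbrSum (wt g) x - k)

/-- Twice the number of edges between coloured vertices. -/
def coloredEdges : ℤ := ∑ x, ind g x * nbrSum (ind g) x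

/-- Twice the number of edges between empty vertices. -/
def emptyEdges : ℤ := ∑ x, (1 - ind g x) * nbrSum (fun y => 1 - ind g y) x

/-- The total weight of the coloured vertices, each counted once for every coloured neighbour. -/
def coloredEdgeWeight : ℤ := ∑ x, ind g x * nbrSum (wt g) x

/-- The sum over all vertices of the weight seen in the neighbourhood, split into the contributions
of the empty and of the coloured vertices. -/
lemma three_mul_weight :
    3 * weight g = excess g + k * (2 * m - numColored g) + coloredEdgeWeight g := by
  have h := sum_one (m := m)
  unfold weight excess numColored coloredEdgeWeight
  rw [← sum_nbrSum, ← h, ← Finset.sum_sub_distrib, Finset.mul_sum, ← Finset.sum_add_distrib,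
    ← Finset.sum_add_distrib]
  exact Finset.sum_congr rfl fun x _ => by ring

/-- Counting edges by their ends in a cubic graph of order `2m`. -/
lemma six_mul_numColored_sub : 6 * (numColored g - m) = coloredEdges g - emptyEdges g := by
  have h := sum_one (m := m)
  have h3 := sum_nbrSum (ind g)
  have : coloredEdges g - emptyEdges g
      = ∑ x, (3 * ind g x + nbrSum (ind g) x - 3 * 1) := by
    unfold coloredEdges emptyEdges
    rw [← Finset.sum_sub_distrib]
    exact Finset.sum_congr rfl fun x _ => by unfold nbrSum; ring
  rw [this, Finset.sum_sub_distrib, Finset.sum_add_distrib, h3, ← Finset.mul_sum, ← Finset.mul_sum,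
    h]
  unfold numColored
  ring

lemma numColored_le_weight : numColored g ≤ weight g :=
  Finset.sum_le_sum fun x _ => ind_le_wt g x

lemma numColored_le : numColored g ≤ 2 * m := by
  have h := sum_one (m := m)
  rw [← h]
  exact Finset.sum_le_sum fun x _ => ind_le_one g x

omit [NeZero m] in
lemma coloredEdges_term_nonneg (x : ZMod (2 * m)) : 0 ≤ ind g x * nbrSum (ind g) x := by
  have := ind_nonneg g
  unfold nbrSum
  have h1 := this (x - 1); have h2 := this (x + 1); have h3 := this (x + m); have h4 := this x
  positivity

omit [NeZero m] in
lemma emptyEdges_term_nonneg (x : ZMod (2 * m)) :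
    0 ≤ (1 - ind g x) * nbrSum (fun y => 1 - ind g y) x := by
  have := fun y => sub_nonneg.2 (ind_le_one g y)
  unfold nbrSum
  have h1 := this (x - 1); have h2 := this (x + 1); have h3 := this (x + m); have h4 := this x
  positivity

lemma coloredEdges_nonneg : 0 ≤ coloredEdges g :=
  Finset.sum_nonneg fun x _ => coloredEdges_term_nonneg g x

lemma emptyEdges_nonneg : 0 ≤ emptyEdges g :=
  Finset.sum_nonneg fun x _ => emptyEdges_term_nonneg g x

lemma coloredEdges_le : coloredEdges g ≤ coloredEdgeWeight g := by
  refine Finset.sum_le_sum fun x _ => mul_le_mul_of_nonneg_left ?_ (ind_nonneg g x)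
  unfold nbrSum
  gcongr <;> exact ind_le_wt g _

variable {g}

omit [NeZero m] in
lemma excess_term_nonneg (hg : IsCirculantDominating m g) (x : ZMod (2 * m)) :
    0 ≤ (1 - ind g x) * (nbrSum (wt g) x - k) := by
  by_cases hx : g x = ∅
  · have := le_nbrSum_of_eq_empty hg hx
    simp only [ind, hx, if_true]
    linarith
  · simp [ind, hx]

lemma excess_nonneg (hg : IsCirculantDominating m g) : 0 ≤ excess g :=
  Finset.sum_nonneg fun x _ => excess_term_nonneg hg x

/-- Each colour class has at least `⌈e / 3⌉` elements, where `e` is the number of empty vertices,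
since a vertex dominates at most three empty ones. -/
lemma mul_le_weight (hg : IsCirculantDominating m g) :
    (k : ℤ) * ((2 * m - numColored g + 2) / 3) ≤ weight g := by
  have h := sum_one (m := m)
  let n : Fin k → ZMod (2 * m) → ℤ := fun c x => if c ∈ g x then 1 else 0
  have hn : ∀ c, (2 * m - numColored g + 2) / 3 ≤ ∑ x, n c x := by
    intro c
    have : 2 * m - numColored g ≤ 3 * ∑ x, n c x := by
      unfold numColored
      rw [← sum_nbrSum, ← h, ← Finset.sum_sub_distrib]
      refine Finset.sum_le_sum fun x _ => ?_
      have hpos : ∀ y, 0 ≤ n c y := fun y => by simp only [n]; split_ifs <;> simp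
      have h1 := hpos (x - 1); have h2 := hpos (x + 1); have h3 := hpos (x + m)
      unfold nbrSum
      by_cases hx : g x = ∅
      · have hc : c ∈ g (x - 1) ∪ g (x + 1) ∪ g (x + m) := by rw [hg x hx]; simp
        simp only [ind, hx, if_true]
        simp only [Finset.mem_union] at hc
        rcases hc with (hc | hc) | hc
        · have : n c (x - 1) = 1 := if_pos hc
          omega
        · have : n c (x + 1) = 1 := if_pos hc
          omega
        · have : n c (x + m) = 1 := if_pos hc
          omega
      · simp only [ind, hx, if_false]
        omega
    omega
  have hw : weight g = ∑ c, ∑ x, n c x := by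
    rw [Finset.sum_comm]
    refine Finset.sum_congr rfl fun x _ => ?_
    simp [n, wt]
  rw [hw]
  calc (k : ℤ) * ((2 * m - numColored g + 2) / 3)
      = ∑ _c : Fin k, (2 * m - numColored g + 2) / 3 := by simp
    _ ≤ _ := Finset.sum_le_sum fun c _ => hn c

lemma eq_empty_of_coloredEdges_eq_zero (h : coloredEdges g = 0) {x : ZMod (2 * m)}
    (hx : g x ≠ ∅) : g (x + 1) = ∅ ∧ g (x + m) = ∅ := by
  have := (Finset.sum_eq_zero_iff_of_nonneg fun x _ => coloredEdges_term_nonneg g x).1 h x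
    (Finset.mem_univ x)
  have hp := ind_nonneg g (x - 1)
  simp only [ind, hx, if_false, nbrSum] at this hp
  constructor <;> by_contra hne <;> simp only [hne, if_false] at this <;>
    split_ifs at this hp <;> omega

lemma ne_empty_of_emptyEdges_eq_zero (h : emptyEdges g = 0) {x : ZMod (2 * m)}
    (hx : g x = ∅) : g (x - 1) ≠ ∅ ∧ g (x + 1) ≠ ∅ ∧ g (x + m) ≠ ∅ := by
  have := (Finset.sum_eq_zero_iff_of_nonneg fun x _ => emptyEdges_term_nonneg g x).1 h x
    (Finset.mem_univ x)
  simp only [ind, hx, if_true, nbrSum] at this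
  refine ⟨fun hne => ?_, fun hne => ?_, fun hne => ?_⟩ <;> simp only [hne, if_true] at this <;>
    split_ifs at this <;> omega

lemma nbrSum_eq_of_excess_eq_zero (hg : IsCirculantDominating m g) (h : excess g = 0)
    {x : ZMod (2 * m)} (hx : g x = ∅) : nbrSum (wt g) x = k := by
  have := (Finset.sum_eq_zero_iff_of_nonneg fun x _ => excess_term_nonneg hg x).1 h x
    (Finset.mem_univ x)
  simp only [ind, hx, if_true] at this
  linarith

end Circulant

/-! ### The two rigidity arguments -/

namespace Circulant

variable {m k : ℕ}

lemma natCast_add_natCast_self : (m : ZMod (2 * m)) + m = 0 := by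
  have := ZMod.natCast_self (2 * m)
  push_cast at this
  linear_combination this

lemma natCast_injOn {i j : ℕ} (hi : i < 2 * m) (hj : j < 2 * m)
    (h : (i : ZMod (2 * m)) = j) : i = j := by
  rw [ZMod.natCast_eq_natCast_iff'] at h
  rwa [Nat.mod_eq_of_lt hi, Nat.mod_eq_of_lt hj] at h

variable [NeZero m] {g : ZMod (2 * m) → Finset (Fin k)}

/-- If every edge joins an empty vertex to a coloured one, the graph is bipartite; but for even `m`
it contains the odd cycle `x, x + 1, ..., x + m`. -/
lemma not_even_of_edges_eq_zero (h : coloredEdges g = 0) (h' : emptyEdges g = 0) : ¬ Even m := by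
  intro hm
  have hs : ∀ x, g (x + 1) = ∅ ↔ ¬ g x = ∅ := fun x =>
    ⟨fun h1 h2 => (ne_empty_of_emptyEdges_eq_zero h' h2).2.1 h1,
      fun h1 => (eq_empty_of_coloredEdges_eq_zero h h1).1⟩
  have hn : ∀ n : ℕ, g (0 + n) = ∅ ↔ (g 0 = ∅ ↔ Even n) := by
    intro n
    induction n with
    | zero => simp
    | succ n ih =>
      rw [Nat.cast_succ, ← add_assoc, hs, ih, Nat.even_add_one]
      tauto
  have := hn m
  by_cases h0 : g 0 = ∅
  · exact (ne_empty_of_emptyEdges_eq_zero h' h0).2.2 (by tauto)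
  · exact absurd (eq_empty_of_coloredEdges_eq_zero h h0).2 (by tauto)

/-- Three sets of colours that cover all `k` colours and have `k` elements in total form a
partition. -/
lemma mem_exactly_one {A B C : Finset (Fin k)} (hu : A ∪ B ∪ C = Finset.univ)
    (hc : A.card + B.card + C.card = k) (c : Fin k) :
    (c ∈ A ∧ c ∉ B ∧ c ∉ C) ∨ (c ∉ A ∧ c ∈ B ∧ c ∉ C) ∨ (c ∉ A ∧ c ∉ B ∧ c ∈ C) := by
  have h1 := Finset.card_union_add_card_inter A B
  have h2 := Finset.card_union_add_card_inter (A ∪ B) C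
  rw [hu, Finset.card_univ, Fintype.card_fin] at h2
  have h3 : A ∩ B = ∅ := Finset.card_eq_zero.1 (by omega)
  have h4 : (A ∪ B) ∩ C = ∅ := Finset.card_eq_zero.1 (by omega)
  have h5 : c ∈ A ∪ B ∪ C := by simp [hu]
  have h6 : c ∉ A ∩ B := by simp [h3]
  have h7 : c ∉ (A ∪ B) ∩ C := by simp [h4]
  simp only [Finset.mem_union, Finset.mem_inter] at h5 h6 h7
  tauto

/-- If no two empty vertices are adjacent and there are `m + 1` coloured vertices, then exactly one
rung `{x, x + m}` has both ends coloured. One of these ends has a coloured successor. -/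
lemma exists_colored_rung (h' : emptyEdges g = 0) (hN : numColored g = m + 1) :
    ∃ x, g x ≠ ∅ ∧ g (x + m) ≠ ∅ ∧ g (x + 1) ≠ ∅ ∧
      ∀ y, y ≠ x → y ≠ x + m → (g (y + m) = ∅ ↔ g y ≠ ∅) := by
  have hmm := natCast_add_natCast_self (m := m)
  let q : ZMod (2 * m) → ℤ := fun x => ind g x + ind g (x + m) - 1
  have hq0 : ∀ x, 0 ≤ q x := by
    intro x
    have h1 := ind_nonneg g (x + m)
    by_cases hx : g x = ∅
    · have := (ne_empty_of_emptyEdges_eq_zero h' hx).2.2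
      simp [q, ind, this, hx]
    · simp only [q, ind, hx, if_false] at h1 ⊢
      omega
  have hq1 : ∀ x, g x ≠ ∅ → g (x + m) ≠ ∅ → q x = 1 := by
    intro x h1 h2
    simp [q, ind, h1, h2]
  have hsum : ∑ x, q x = 2 := by
    have h2 : ∑ x, ind g (x + m) = ∑ x, ind g x :=
      Equiv.sum_comp (Equiv.addRight (m : ZMod (2 * m))) (ind g)
    rw [Finset.sum_sub_distrib, Finset.sum_add_distrib, h2, sum_one]
    change numColored g + numColored g - 2 * m = 2
    omega
  obtain ⟨x, hx1, hx2⟩ : ∃ x, g x ≠ ∅ ∧ g (x + m) ≠ ∅ := by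
    by_contra! hcon
    have : ∑ x, q x ≤ 0 := by
      refine Finset.sum_nonpos fun x _ => ?_
      have h1 := ind_le_one g x
      have h2 := ind_le_one g (x + m)
      by_cases hx : g x = ∅
      · simp only [q, ind, hx, if_true] at h2 ⊢
        omega
      · have hy := hcon x (Finset.nonempty_iff_ne_empty.2 hx)
        simp only [q, ind, hy, if_true] at h1 ⊢
        omega
    omega
  have hm0 : (m : ZMod (2 * m)) ≠ 0 := by
    intro h0
    have hm := NeZero.pos m
    have := natCast_injOn (m := m) (i := m) (j := 0) (by omega) (by omega) (by simpa using h0)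
    omega
  have huniq : ∀ y, y ≠ x → y ≠ x + m → (g (y + m) = ∅ ↔ g y ≠ ∅) := by
    intro y hy1 hy2
    refine ⟨fun h1 h2 => (ne_empty_of_emptyEdges_eq_zero h' h2).2.2 h1, fun h1 => ?_⟩
    by_contra h2
    have h3 : ∑ z ∈ {x, x + (m : ZMod (2 * m)), y}, q z ≤ ∑ z, q z :=
      Finset.sum_le_univ_sum_of_nonneg hq0
    have hne : x ≠ x + m := fun h => hm0 (by linear_combination -h)
    rw [Finset.sum_insert (by simp [hne, hy1.symm]), Finset.sum_insert (by simp [hy2.symm]),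
      Finset.sum_singleton, hq1 x hx1 hx2, hq1 y h1 h2,
      hq1 (x + m) hx2 (by rwa [add_assoc, hmm, add_zero]), hsum] at h3
    omega
  by_cases h1 : g (x + 1) = ∅
  · refine ⟨x + m, hx2, by rwa [add_assoc, hmm, add_zero], ?_, fun y hy1 hy2 =>
      huniq y (by rwa [add_assoc, hmm, add_zero] at hy2) hy1⟩
    have := (ne_empty_of_emptyEdges_eq_zero h' h1).2.2
    rwa [add_right_comm] at this
  · exact ⟨x, hx1, hx2, h1, huniq⟩

/-- Suppose that no two empty vertices are adjacent, that every empty vertex sees every colour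
exactly once, and that there are `m + 1` coloured vertices. Away from one rung the coloured and the
empty vertices alternate, and the colour sets met along the ladder are periodic with period three
from that rung around to itself. So `m ≡ 1 (mod 3)` would force two disjoint sets to coincide. -/
lemma not_mod_three_eq_one (hg : IsCirculantDominating m g) (hodd : Odd m) (hS : excess g = 0)
    (h' : emptyEdges g = 0) (hN : numColored g = m + 1) : m % 3 ≠ 1 ∨ m < 2 := by
  by_contra! ⟨hm3, hm2⟩
  have hmm := natCast_add_natCast_self (m := m)
  obtain ⟨x, hx, hxm, hx1, huniq⟩ := exists_colored_rung h' hN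
  have hne : ∀ i : ℕ, 0 < i → i < m → (g (x + i + m) = ∅ ↔ g (x + i) ≠ ∅) := by
    intro i hi him
    refine huniq _ (fun h => ?_) (fun h => ?_)
    · have := natCast_injOn (m := m) (i := i) (j := 0) (by omega) (by omega)
        (by push_cast; linear_combination h)
      omega
    · have := natCast_injOn (m := m) (i := i) (j := m) (by omega) (by omega)
        (by linear_combination h)
      omega
  have halt : ∀ i : ℕ, i + 1 < m → (g (x + (i + 1 : ℕ)) = ∅ ↔ Odd i) := by
    intro i
    induction i with
    | zero => intro _; simpa using hx1
    | succ i ih =>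
      intro hi
      have ih := ih (by omega)
      have hs : x + ((i + 1 + 1 : ℕ) : ZMod (2 * m)) = x + (i + 1 : ℕ) + 1 := by push_cast; ring
      rw [Nat.odd_add_one, ← ih]
      refine ⟨fun h1 h2 => (ne_empty_of_emptyEdges_eq_zero h' h2).2.1 (by rwa [← hs]),
        fun h1 => ?_⟩
      -- two consecutive coloured vertices would be opposite two consecutive empty ones
      have h2 := (hne (i + 1) (by omega) (by omega)).2 h1
      have h3 := (ne_empty_of_emptyEdges_eq_zero h' h2).2.1
      by_contra h4
      refine h3 ?_
      rw [add_right_comm, ← hs]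
      exact (hne (i + 1 + 1) (by omega) hi).2 h4
  -- The coloured end of the `i`-th rung after `x`. For `i = 0` and, as `m` is odd, for `i = m`, the
  -- vertex chosen is `x + m`.
  let D : ℕ → Finset (Fin k) := fun i => if Odd i then g (x + i) else g (x + i + m)
  have htriple : ∀ i, i + 2 ≤ m → ∃ y, g y = ∅ ∧
      g (y - 1) = D i ∧ g (y + 1) = D (i + 2) ∧ g (y + m) = D (i + 1) := by
    intro i hi
    have hi2 := hne (i + 1) (by omega) (by omega)
    have ha := halt i (by omega)
    by_cases hpar : Odd i
    · have h1 : ¬ Odd (i + 1) := by rw [Nat.odd_add_one]; tauto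
      have h2 : Odd (i + 2) := by rw [Nat.odd_add_one]; exact h1
      refine ⟨x + (i + 1 : ℕ), ha.2 hpar, ?_, ?_, ?_⟩
      · simp only [D, hpar, if_true]; congr 1; push_cast; ring
      · simp only [D, h2, if_true]; congr 1; push_cast; ring
      · simp only [D, h1, if_false]
    · have h1 : Odd (i + 1) := by rw [Nat.odd_add_one]; exact hpar
      have h2 : ¬ Odd (i + 2) := by rw [Nat.odd_add_one]; tauto
      refine ⟨x + (i + 1 : ℕ) + m, hi2.2 (fun h => hpar (ha.1 h)), ?_, ?_, ?_⟩
      · simp only [D, hpar, if_false]; congr 1; push_cast; ring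
      · simp only [D, h2, if_false]; congr 1; push_cast; ring
      · simp only [D, h1, if_true]; congr 1; rw [add_assoc, hmm, add_zero]
  have hpart : ∀ i, i + 2 ≤ m → ∀ c, (c ∈ D i ∧ c ∉ D (i + 2) ∧ c ∉ D (i + 1)) ∨
      (c ∉ D i ∧ c ∈ D (i + 2) ∧ c ∉ D (i + 1)) ∨ (c ∉ D i ∧ c ∉ D (i + 2) ∧ c ∈ D (i + 1)) := by
    intro i hi c
    obtain ⟨y, hy, h1, h2, h3⟩ := htriple i hi
    have hs := nbrSum_eq_of_excess_eq_zero hg hS hy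
    have hu := hg y hy
    unfold nbrSum wt at hs
    rw [h1, h2, h3] at hs hu
    exact mem_exactly_one hu (by exact_mod_cast hs) c
  have hper : ∀ i, i + 3 ≤ m → D (i + 3) = D i := by
    intro i hi
    ext c
    have h1 := hpart i (by omega) c
    have h2 := hpart (i + 1) (by omega) c
    have e : i + 1 + 2 = i + 3 := rfl
    have e' : i + 1 + 1 = i + 2 := rfl
    rw [e, e'] at h2
    tauto
  have hper' : ∀ j, 3 * j ≤ m → D (3 * j) = D 0 := by
    intro j
    induction j with
    | zero => intro _; rfl
    | succ j ih =>
      intro hj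
      rw [← ih (by omega), ← hper (3 * j) (by omega)]
      rfl
  have h0 : D 0 = g (x + m) := by simp [D]
  have hm : D m = g (x + m) := by simp [D, hodd]
  have h1 := hper' (m / 3) (by omega)
  have e : 3 * (m / 3) = m - 2 + 1 := by omega
  rw [e] at h1
  obtain ⟨c, hc⟩ := Finset.nonempty_iff_ne_empty.2 hxm
  have h2 := hpart (m - 2) (by omega) c
  rw [Nat.sub_add_cancel hm2, h1, h0, hm] at h2
  tauto

end Circulant

/-! ### Lower bounds on the circulant graph -/

namespace Circulant

variable {m : ℕ} [NeZero m]

/-- The numerical constraints from which the lower bounds for `k ≥ 3` follow: `N` is the number of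
coloured vertices, `S` the excess, `Q` the weight on edges between coloured vertices, and `E` twice
the number of edges between empty vertices. The last two clauses are the rigidity arguments. -/
lemma exists_numColored {k : ℕ} {g : ZMod (2 * m) → Finset (Fin k)}
    (hg : IsCirculantDominating m g) :
    ∃ N S Q E : ℤ, 0 ≤ S ∧ 0 ≤ E ∧ 0 ≤ Q ∧ 6 * (N - m) + E ≤ Q ∧
      3 * weight g = S + k * (2 * m - N) + Q ∧ N ≤ weight g ∧ N ≤ 2 * m ∧
      (k : ℤ) * ((2 * m - N + 2) / 3) ≤ weight g ∧
      (N = m → Q = 0 → E = 0 → m % 2 ≠ 0) ∧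
      (N = m + 1 → S = 0 → E = 0 → m % 6 = 1 → m < 2) := by
  have h1 := six_mul_numColored_sub g
  have h2 := coloredEdges_le g
  have h3 := coloredEdges_nonneg g
  refine ⟨numColored g, excess g, coloredEdgeWeight g, emptyEdges g, excess_nonneg hg,
    emptyEdges_nonneg g, by omega, by omega, three_mul_weight g, numColored_le_weight g,
    numColored_le g, mul_le_weight hg, fun _ hQ hE h => ?_, fun hN hS hE hm => ?_⟩
  · exact not_even_of_edges_eq_zero (by omega) hE (Nat.even_iff.2 h)
  · have := not_mod_three_eq_one hg (Nat.odd_iff.2 (by omega)) hS hE hN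
    omega

theorem le_weight_three {g : ZMod (2 * m) → Finset (Fin 3)} (hg : IsCirculantDominating m g)
    (hm : 2 ≤ m) :
    (m : ℤ) + (if m % 6 = 3 then 0 else if m % 6 = 1 then 2 else 1) ≤ weight g := by
  obtain ⟨N, S, Q, E, h1, h2, h3, h4, h5, h6, h7, h8, h9, h10⟩ := exists_numColored hg
  push_cast at h5 h8
  have h11 : N ≤ m ∨ N = m + 1 ∨ m + 2 ≤ N := by omega
  rcases h11 with h11 | h11 | h11 <;> split_ifs <;> omega

theorem le_weight_four {g : ZMod (2 * m) → Finset (Fin 4)} (hg : IsCirculantDominating m g)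
    (hm : 2 ≤ m) :
    (4 * m + 2 : ℤ) / 3 + (if m % 6 = 3 ∨ m % 6 = 4 then 0 else 1) ≤ weight g := by
  obtain ⟨N, S, Q, E, h1, h2, h3, h4, h5, h6, h7, h8, h9, h10⟩ := exists_numColored hg
  push_cast at h5 h8
  have h11 : N < m ∨ N = m ∨ N = m + 1 ∨ m + 2 ≤ N := by omega
  have h12 : m % 6 = 0 ∨ m % 6 = 1 ∨ m % 6 = 2 ∨ m % 6 = 3 ∨ m % 6 = 4 ∨ m % 6 = 5 := by omega
  rcases h11 with h11 | h11 | h11 | h11 <;> rcases h12 with h12 | h12 | h12 | h12 | h12 | h12 <;>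
    split_ifs <;> omega

theorem le_weight_five {g : ZMod (2 * m) → Finset (Fin 5)} (hg : IsCirculantDominating m g)
    (hm : 2 ≤ m) :
    (5 * m + 2 : ℤ) / 3 + (if m % 6 = 0 ∨ m % 6 = 1 then 1 else 0) ≤ weight g := by
  obtain ⟨N, S, Q, E, h1, h2, h3, h4, h5, h6, h7, h8, h9, h10⟩ := exists_numColored hg
  push_cast at h5 h8
  have h11 : N < m ∨ N = m ∨ N = m + 1 ∨ m + 2 ≤ N := by omega
  rcases h11 with h11 | h11 | h11 | h11 <;> split_ifs <;> omega

theorem le_weight_of_six_le {k : ℕ} (hk : 6 ≤ k) {g : ZMod (2 * m) → Finset (Fin k)}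
    (hg : IsCirculantDominating m g) : (2 * m : ℤ) ≤ weight g := by
  obtain ⟨N, S, Q, E, h1, h2, h3, h4, h5, h6, h7, -⟩ := exists_numColored hg
  have : (6 : ℤ) * (2 * m - N) ≤ k * (2 * m - N) :=
    mul_le_mul_of_nonneg_right (by exact_mod_cast hk) (by omega)
  omega

/-- A rung without colours needs four colours on the two neighbouring rungs, so that a rung of
weight `b > 1` can pass `(b - 1) / 2` to each of its neighbours, after which each rung has weight at
least one. -/
theorem le_weight_two {g : ZMod (2 * m) → Finset (Fin 2)} (hg : IsCirculantDominating m g) :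
    (m : ℤ) ≤ weight g := by
  have hmm := natCast_add_natCast_self (m := m)
  have hw0 : ∀ x, 0 ≤ wt g x := fun x => by unfold wt; positivity
  let b : ZMod (2 * m) → ℤ := fun x => wt g x + wt g (x + m)
  let c : ZMod (2 * m) → ℤ := fun x => max (b x - 1) 0
  have hc : ∑ x, c (x - 1) = ∑ x, c x := Equiv.sum_comp (Equiv.subRight (1 : ZMod (2 * m))) c
  have hc' : ∑ x, c (x + 1) = ∑ x, c x := Equiv.sum_comp (Equiv.addRight (1 : ZMod (2 * m))) c
  have hb : ∑ x, wt g (x + m) = ∑ x, wt g x :=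
    Equiv.sum_comp (Equiv.addRight (m : ZMod (2 * m))) (wt g)
  have key : ∀ x, 2 * 1 ≤ 2 * b x + c (x - 1) + c (x + 1) - 2 * c x := by
    intro x
    have e1 := le_max_left (b (x - 1) - 1) 0
    have e2 := le_max_left (b (x + 1) - 1) 0
    have e3 := le_max_right (b (x - 1) - 1) 0
    have e4 := le_max_right (b (x + 1) - 1) 0
    have h1 := hw0 x
    have h2 := hw0 (x + m)
    by_cases hx : b x = 0
    · have h3 : wt g x = 0 := by simp only [b] at hx; omega
      have h4 : wt g (x + m) = 0 := by simp only [b] at hx; omega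
      have h5 := le_nbrSum_of_eq_empty hg (x := x) (Finset.card_eq_zero.1 (by simpa [wt] using h3))
      have h6 := le_nbrSum_of_eq_empty hg (x := x + m)
        (Finset.card_eq_zero.1 (by simpa [wt] using h4))
      unfold nbrSum at h5 h6
      rw [add_assoc x m m, hmm, add_zero, h3, add_sub_right_comm, add_right_comm x] at h6
      have h7 : c x = 0 := by simp [c, hx]
      simp only [b, c] at *
      push_cast at h5 h6
      omega
    · have h7 : c x = b x - 1 := max_eq_left (by simp only [b] at *; omega)
      simp only [c] at *
      omega
  have h := Finset.sum_le_sum fun x (_ : x ∈ Finset.univ) => key x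
  rw [← Finset.mul_sum, sum_one, Finset.sum_sub_distrib, Finset.sum_add_distrib,
    Finset.sum_add_distrib, ← Finset.mul_sum, ← Finset.mul_sum, hc, hc', Finset.sum_add_distrib,
    hb] at h
  change 2 * (2 * m) ≤ 2 * (weight g + weight g) + _ + _ - _ at h
  omega

omit [NeZero m] in
lemma one_le_closed_nbrSum {g : ZMod (2 * m) → Finset (Fin 1)} (hg : IsCirculantDominating m g)
    (x : ZMod (2 * m)) : 1 ≤ wt g x + nbrSum (wt g) x := by
  have hw0 : ∀ x, 0 ≤ wt g x := fun x => by unfold wt; positivity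
  by_cases hx : g x = ∅
  · have := le_nbrSum_of_eq_empty hg hx
    have := hw0 x
    push_cast at *
    omega
  · have h1 := ind_le_wt g x
    have h2 := hw0 (x - 1)
    have h3 := hw0 (x + 1)
    have h4 := hw0 (x + m)
    simp only [ind, hx, if_false] at h1
    unfold nbrSum
    omega

/-- Every vertex lies in four closed neighbourhoods. -/
lemma sum_closed_nbrSum_sub_one {g : ZMod (2 * m) → Finset (Fin 1)} :
    ∑ x, (wt g x + nbrSum (wt g) x - 1) = 4 * weight g - 2 * m := by
  rw [Finset.sum_sub_distrib, Finset.sum_add_distrib, sum_nbrSum, sum_one]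
  unfold weight
  ring

/-- For `4 ∣ m` there is no perfect code: a perfect code is invariant under translation by `m + 2`,
hence by `4`, hence by `m`, but `x` and `x + m` are adjacent. -/
lemma four_mul_weight_ne (hm : m % 4 = 0) {g : ZMod (2 * m) → Finset (Fin 1)}
    (hg : IsCirculantDominating m g) : 4 * weight g ≠ 2 * m := by
  intro hw
  have hmm := natCast_add_natCast_self (m := m)
  have hw0 : ∀ x, 0 ≤ wt g x := fun x => by unfold wt; positivity
  have hex : ∀ x, wt g x + wt g (x - 1) + wt g (x + 1) + wt g (x + m) = 1 := by
    intro x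
    have h := sum_closed_nbrSum_sub_one (g := g)
    rw [hw, sub_self, Finset.sum_eq_zero_iff_of_nonneg
      fun x _ => sub_nonneg.2 (one_le_closed_nbrSum hg x)] at h
    have := h x (Finset.mem_univ x)
    unfold nbrSum at this
    omega
  have hstep : ∀ x, wt g x = 1 → wt g (x + m + 2) = 1 := by
    intro x hx
    -- The vertices `x + m + 1`, `x + m` and `x + 1` lie within distance two of `x`, hence carry no
    -- colour, so `x + m + 1` has to be dominated by `x + m + 2`.
    have h0 := hex x
    have h1 := hex (x + 1)
    have h2 := hex (x + m)
    have h3 := hex (x + m + 1)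
    have e1 : x + m + m = x := by rw [add_assoc, hmm, add_zero]
    have e2 : x + m + 1 + m = x + 1 := by linear_combination hmm
    have e3 : x + m + 1 + 1 = x + m + 2 := by ring
    rw [add_sub_cancel_right] at h1 h3
    rw [e1] at h2
    rw [e2, e3] at h3
    have := hw0 (x - 1); have := hw0 (x + 1); have := hw0 (x + m); have := hw0 (x + m - 1)
    have := hw0 (x + m + 1); have := hw0 (x + 1 + 1); have := hw0 (x + 1 + m)
    omega
  have hfour : ∀ (j : ℕ) x, wt g x = 1 → wt g (x + 4 * j) = 1 := by
    intro j
    induction j with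
    | zero => intro x hx; simpa using hx
    | succ j ih =>
      intro x hx
      have := hstep _ (hstep _ (ih x hx))
      have e : x + 4 * j + m + 2 + m + 2 = x + 4 * (j + 1 : ℕ) := by
        push_cast
        linear_combination hmm
      rwa [e] at this
  obtain ⟨x, hx⟩ : ∃ x, wt g x = 1 := by
    have h := hex 0
    have h1 := hw0 0
    have h2 := hw0 (0 - 1)
    have h3 := hw0 (0 + 1)
    have h4 := hw0 (0 + m)
    by_contra! hne
    have := hne 0
    have := hne (0 - 1)
    have := hne (0 + 1)
    have := hne (0 + m)
    omega
  have h1 := hfour (m / 4) x hx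
  have e : (4 : ZMod (2 * m)) * (m / 4 : ℕ) = m := by
    have : 4 * (m / 4) = m := by omega
    exact_mod_cast congrArg (Nat.cast (R := ZMod (2 * m))) this
  rw [e] at h1
  have h := hex x
  have := hw0 (x - 1)
  have := hw0 (x + 1)
  omega

theorem le_weight_one {g : ZMod (2 * m) → Finset (Fin 1)} (hg : IsCirculantDominating m g) :
    ((m : ℤ) + 1) / 2 + (if m % 4 = 0 then 1 else 0) ≤ weight g := by
  have h : 0 ≤ ∑ x, (wt g x + nbrSum (wt g) x - 1) :=
    Finset.sum_nonneg fun x _ => sub_nonneg.2 (one_le_closed_nbrSum hg x)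
  rw [sum_closed_nbrSum_sub_one] at h
  split_ifs with hm
  · have := four_mul_weight_ne hm hg
    omega
  · omega

end Circulant

/-! ### The Möbius ladder as a circulant graph -/

section Transfer

variable {m : ℕ}

/-- The position of a vertex on the Hamiltonian cycle `u₀, ..., u_{m-1}, v₀, ..., v_{m-1}`. -/
def ladderToCirculant (p : Fin m × Bool) : ZMod (2 * m) :=
  ((p.1.val + if p.2 then m else 0 : ℕ) : ZMod (2 * m))

lemma ladderToCirculant_bijective [NeZero m] :
    Function.Bijective (ladderToCirculant (m := m)) := by
  rw [Fintype.bijective_iff_injective_and_card]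
  refine ⟨?_, by simp [ZMod.card, mul_comm]⟩
  rintro ⟨⟨i, hi⟩, b⟩ ⟨⟨j, hj⟩, c⟩ h
  have h := Circulant.natCast_injOn (by dsimp only; split_ifs <;> omega)
    (by dsimp only; split_ifs <;> omega) h
  cases b <;> cases c <;> simp at h ⊢ <;> omega

lemma ladderToCirculant_of_adj {p q : Fin m × Bool} (h : (mobiusLadder m).Adj p q) :
    ladderToCirculant q = ladderToCirculant p - 1 ∨ ladderToCirculant q = ladderToCirculant p + 1 ∨
      ladderToCirculant q = ladderToCirculant p + m := by
  have hmm := Circulant.natCast_add_natCast_self (m := m)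
  have key : ∀ p q : Fin m × Bool, (p.1 = q.1 ∧ p.2 ≠ q.2) ∨
      (p.1.val + 1 = q.1.val ∧ p.2 = q.2) ∨
      (p.1.val + 1 = m ∧ q.1.val = 0 ∧ p.2 ≠ q.2) →
      ladderToCirculant q = ladderToCirculant p + m ∨
        ladderToCirculant q = ladderToCirculant p + 1 := by
    rintro ⟨i, b⟩ ⟨j, c⟩ (⟨h1, h2⟩ | ⟨h1, h2⟩ | ⟨h1, h2, h3⟩)
    · left
      dsimp only at h1 h2
      subst h1
      cases b <;> cases c <;> simp [ladderToCirculant, add_assoc, hmm] at h2 ⊢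
    · right
      dsimp only at h1 h2
      subst h2
      simp only [ladderToCirculant, ← h1]
      push_cast
      ring
    · right
      dsimp only at h1 h2 h3
      have h1 : (i.val : ZMod (2 * m)) + 1 = m := by exact_mod_cast congrArg Nat.cast h1
      cases b <;> cases c <;> simp [ladderToCirculant, h2] at h3 ⊢
      · exact h1.symm
      · linear_combination -h1 - hmm
  rw [mobiusLadder, SimpleGraph.fromRel_adj] at h
  rcases h.2 with h | h
  · rcases key p q h with h | h <;> tauto
  · rcases key q p h with h | h
    · right; right; linear_combination -h - hmm
    · left; linear_combination -h

/-- Every rainbow dominating function on the Möbius ladder gives one of the same weight on the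
circulant graph, so that lower bounds on the circulant graph transfer to the ladder. -/
lemma le_rainbowDominationNumber [NeZero m] {k : ℕ} {b : ℤ}
    (h : ∀ g : ZMod (2 * m) → Finset (Fin k), IsCirculantDominating m g → b ≤ Circulant.weight g) :
    b ≤ rainbowDominationNumber (mobiusLadder m) k := by
  obtain ⟨f, hf, hw⟩ := (isLeast_rainbowDominationNumber (mobiusLadder m) k).1
  let e := Equiv.ofBijective _ (ladderToCirculant_bijective (m := m))
  have hg : IsCirculantDominating m (f ∘ e.symm) := by
    intro x hx
    have h1 := hf (e.symm x) hx
    ext c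
    have h2 : c ∈ ⋃ u ∈ (mobiusLadder m).neighborSet (e.symm x), (f u : Set (Fin k)) := by
      rw [h1]; trivial
    simp only [Set.mem_iUnion, SimpleGraph.mem_neighborSet] at h2
    obtain ⟨u, hu, hc⟩ := h2
    have hc : c ∈ f (e.symm (e u)) := by simpa using hc
    have hx : ladderToCirculant (e.symm x) = x := e.apply_symm_apply x
    have := ladderToCirculant_of_adj hu
    rw [hx] at this
    change e u = _ ∨ e u = _ ∨ e u = _ at this
    simp only [Finset.mem_union, Finset.mem_univ, iff_true, Function.comp]
    rcases this with h | h | h <;> rw [h] at hc <;> tauto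
  refine (h _ hg).trans_eq ?_
  rw [← hw, rainbowWeight, Circulant.weight]
  push_cast
  exact Equiv.sum_comp e.symm fun v => ((f v).card : ℤ)

end Transfer

/-! ### Colourings built column by column -/

/-- The colours of the pair `(u_i, v_i)`. -/
abbrev Column (k : ℕ) : Type := Finset (Fin k) × Finset (Fin k)

namespace Column

variable {k : ℕ}

/-- The empty vertices of the middle one of three consecutive columns see all colours. -/
def Dominated (x y z : Column k) : Prop :=
  (y.1 = ∅ → x.1 ∪ y.2 ∪ z.1 = Finset.univ) ∧ (y.2 = ∅ → x.2 ∪ y.1 ∪ z.2 = Finset.univ)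

instance (x y z : Column k) : Decidable (Dominated x y z) := by
  unfold Dominated; infer_instance

/-- The number of colours in a column. -/
def wt (x : Column k) : ℕ := x.1.card + x.2.card

/-- The columns `F 0, ..., F (m - 1)` form a `k`-rainbow dominating function on the Möbius ladder.
The neighbours of the end columns are the columns of the other end, with the two rows exchanged. -/
structure IsMobius (m : ℕ) (F : ℕ → Column k) : Prop where
  inner : ∀ i, i + 2 < m → Dominated (F i) (F (i + 1)) (F (i + 2))
  first : Dominated (F (m - 1)).swap (F 0) (F 1)
  last : Dominated (F (m - 2)) (F (m - 1)) (F 0).swap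

/-- The colouring of the ladder with columns `F`. -/
def toFun {m : ℕ} (F : ℕ → Column k) (p : Fin m × Bool) : Finset (Fin k) :=
  if p.2 then (F p.1).2 else (F p.1).1

lemma rainbowWeight_toFun {m : ℕ} (F : ℕ → Column k) :
    rainbowWeight (toFun (m := m) F) = ∑ i ∈ Finset.range m, (F i).wt := by
  rw [rainbowWeight, Fintype.sum_prod_type, ← Fin.sum_univ_eq_sum_range fun i => (F i).wt]
  refine Finset.sum_congr rfl fun i _ => ?_
  simp [toFun, wt, add_comm]

lemma IsMobius.isRainbowDominating {m : ℕ} (hm : 2 ≤ m) {F : ℕ → Column k} (h : IsMobius m F) :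
    IsRainbowDominating (mobiusLadder m) k (toFun F) := by
  have key : ∀ (i : ℕ) (hi : i < m) (b : Bool), ∃ p q : Fin m × Bool,
      (mobiusLadder m).Adj (⟨i, hi⟩, b) p ∧ (mobiusLadder m).Adj (⟨i, hi⟩, b) q ∧
      (toFun F (⟨i, hi⟩, b) = ∅ →
        toFun F p ∪ toFun F (⟨i, hi⟩, !b) ∪ toFun F q = Finset.univ) := by
    intro i hi b
    simp only [mobiusLadder, SimpleGraph.fromRel_adj]
    by_cases h0 : i = 0
    · subst h0
      refine ⟨(⟨m - 1, by omega⟩, !b), (⟨1, by omega⟩, b), ⟨?_, ?_⟩, ⟨?_, ?_⟩, ?_⟩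
      · cases b <;> simp
      · right; right; right; cases b <;> simp <;> omega
      · simp
      · left; right; left; simp
      · cases b
        · exact h.first.1
        · exact h.first.2
    · by_cases hl : i = m - 1
      · subst hl
        refine ⟨(⟨m - 2, by omega⟩, b), (⟨0, by omega⟩, !b), ⟨?_, ?_⟩, ⟨?_, ?_⟩, ?_⟩
        · simp; omega
        · right; right; left; simp; omega
        · cases b <;> simp
        · left; right; right; cases b <;> simp <;> omega
        · cases b
          · exact h.last.1
          · exact h.last.2
      · obtain ⟨i, rfl⟩ := Nat.exists_eq_succ_of_ne_zero h0
        refine ⟨(⟨i, by omega⟩, b), (⟨i + 2, by omega⟩, b), ⟨?_, ?_⟩, ⟨?_, ?_⟩, ?_⟩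
        · simp
        · right; right; left; simp
        · simp
        · left; right; left; simp
        · cases b
          · exact (h.inner i (by omega)).1
          · exact (h.inner i (by omega)).2
  rintro ⟨⟨i, hi⟩, b⟩ he
  obtain ⟨p, q, hp, hq, hu⟩ := key i hi b
  have hr : (mobiusLadder m).Adj (⟨i, hi⟩, b) (⟨i, hi⟩, !b) := by
    simp [mobiusLadder, SimpleGraph.fromRel_adj]
  ext c
  have hc : c ∈ toFun F p ∪ toFun F (⟨i, hi⟩, !b) ∪ toFun F q := by rw [hu he]; simp
  simp only [Finset.mem_union] at hc
  simp only [Set.mem_iUnion, SimpleGraph.mem_neighborSet, Set.mem_univ, iff_true]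
  rcases hc with (hc | hc) | hc
  · exact ⟨_, hp, hc⟩
  · exact ⟨_, hr, hc⟩
  · exact ⟨_, hq, hc⟩

/-- A word of columns that is dominating on the Möbius ladder of its length. -/
def IsMobiusWord (B : List (Column k)) : Prop :=
  (∀ i < B.length - 2, Dominated (B.getD i default) (B.getD (i + 1) default)
    (B.getD (i + 2) default)) ∧
  Dominated (B.getD (B.length - 1) default).swap (B.getD 0 default) (B.getD 1 default) ∧
  Dominated (B.getD (B.length - 2) default) (B.getD (B.length - 1) default)
    (B.getD 0 default).swap

instance (B : List (Column k)) : Decidable (IsMobiusWord B) := by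
  unfold IsMobiusWord; infer_instance

lemma IsMobiusWord.isMobius {B : List (Column k)} (hB : IsMobiusWord B) :
    IsMobius B.length fun i => B.getD i default :=
  ⟨fun i hi => hB.1 i (by omega), hB.2.1, hB.2.2⟩

lemma sum_wt_getD (B : List (Column k)) :
    ∑ i ∈ Finset.range B.length, (B.getD i default).wt = (B.map wt).sum := by
  rw [Finset.sum_range, ← Fin.sum_univ_fun_getElem]
  exact Finset.sum_congr rfl fun i _ => by rw [List.getD_eq_getElem _ _ i.2]

/-- The word `P` repeats: its cyclic repetition is dominating. -/
def IsPeriodWord (P : List (Column k)) : Prop :=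
  ∀ i < P.length, Dominated (P.getD i default) (P.getD ((i + 1) % P.length) default)
    (P.getD ((i + 2) % P.length) default)

instance (P : List (Column k)) : Decidable (IsPeriodWord P) := by
  unfold IsPeriodWord; infer_instance

/-- A period can be inserted in front of a dominating colouring that begins with the first two
columns of the period. -/
lemma IsMobius.pump {m : ℕ} (hm : 2 ≤ m) {F : ℕ → Column k} (hF : IsMobius m F)
    {P : List (Column k)} (hP2 : 2 ≤ P.length) (hP : IsPeriodWord P)
    (h0 : F 0 = P.getD 0 default) (h1 : F 1 = P.getD 1 default) :
    ∃ F' : ℕ → Column k, IsMobius (m + P.length) F' ∧ F' 0 = F 0 ∧ F' 1 = F 1 ∧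
      ∑ i ∈ Finset.range (m + P.length), (F' i).wt
        = ∑ i ∈ Finset.range m, (F i).wt + (P.map wt).sum := by
  set p := P.length with hp
  let F' : ℕ → Column k := fun i => if i < p then P.getD i default else F (i - p)
  have hlt : ∀ i, i < p → F' i = P.getD i default := fun i hi => if_pos hi
  have hge : ∀ i, F' (p + i) = F i := fun i => by simp [F']
  -- the first two columns after the period agree with its cyclic continuation
  have hcyc : ∀ i, i < p + 2 → F' i = P.getD (i % p) default := by
    intro i hi
    rcases lt_or_ge i p with h | h
    · rw [hlt i h, Nat.mod_eq_of_lt h]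
    · obtain ⟨j, rfl⟩ := Nat.exists_eq_add_of_le h
      rw [hge, Nat.add_mod_left, Nat.mod_eq_of_lt (by omega)]
      have : j = 0 ∨ j = 1 := by omega
      rcases this with rfl | rfl
      · exact h0
      · exact h1
  have hF0 : F' 0 = F 0 := by rw [hlt 0 (by omega), h0]
  have hF1 : F' 1 = F 1 := by rw [hlt 1 (by omega), h1]
  have e1 : m + p - 1 = p + (m - 1) := by omega
  have e2 : m + p - 2 = p + (m - 2) := by omega
  refine ⟨F', ⟨fun i hi => ?_, ?_, ?_⟩, hF0, hF1, ?_⟩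
  · rcases lt_or_ge i p with h | h
    · have := hP i h
      rwa [← hp, ← hcyc (i + 1) (by omega), ← hcyc (i + 2) (by omega), ← hlt i h] at this
    · obtain ⟨j, rfl⟩ := Nat.exists_eq_add_of_le h
      rw [add_assoc, add_assoc, hge, hge, hge]
      exact hF.inner j (by omega)
  · rw [e1, hge, hF0, hF1]
    exact hF.first
  · rw [e1, e2, hge, hge, hF0]
    exact hF.last
  · rw [add_comm m, Finset.sum_range_add, add_comm]
    congr 1
    · exact Finset.sum_congr rfl fun i _ => by rw [hge]
    · rw [← sum_wt_getD]
      exact Finset.sum_congr rfl fun i hi => congrArg wt (hlt i (Finset.mem_range.1 hi))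

/-- Inserting `q` periods `P` of length `n` and weight `w` in front of a dominating word `B` of
length `L` and weight `b` that starts like `P`. -/
theorem rainbowDominationNumber_le_of_words {m L b n w q : ℕ} (B P : List (Column k))
    (h : B.length = L ∧ (B.map wt).sum = b ∧ P.length = n ∧ (P.map wt).sum = w ∧ 2 ≤ L ∧ 2 ≤ n ∧
      IsMobiusWord B ∧ IsPeriodWord P ∧ B.getD 0 default = P.getD 0 default ∧
      B.getD 1 default = P.getD 1 default) (hm : m = L + q * n) :
    rainbowDominationNumber (mobiusLadder m) k ≤ b + q * w := by
  obtain ⟨rfl, rfl, rfl, rfl, hL, hn, hB, hP, h0, h1⟩ := h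
  have key : ∀ q : ℕ, ∃ F : ℕ → Column k, IsMobius (B.length + q * P.length) F ∧
      F 0 = P.getD 0 default ∧ F 1 = P.getD 1 default ∧
      ∑ i ∈ Finset.range (B.length + q * P.length), (F i).wt
        = (B.map wt).sum + q * (P.map wt).sum := by
    intro q
    induction q with
    | zero =>
      refine ⟨fun i => B.getD i default, ?_, h0, h1, ?_⟩
      · simpa using hB.isMobius
      · simpa using sum_wt_getD B
    | succ q ih =>
      obtain ⟨F, hF, hF0, hF1, hs⟩ := ih
      obtain ⟨F', hF', hF0', hF1', hs'⟩ := hF.pump (by omega) hn hP hF0 hF1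
      have e : B.length + (q + 1) * P.length = B.length + q * P.length + P.length := by ring
      refine ⟨F', by rwa [e], by rw [hF0', hF0], by rw [hF1', hF1], ?_⟩
      rw [e, hs', hs]
      ring
  obtain ⟨F, hF, -, -, hs⟩ := key q
  rw [← hm] at hF hs
  rw [← hs, ← rainbowWeight_toFun (m := m)]
  exact (isLeast_rainbowDominationNumber _ _).2 ⟨_, hF.isRainbowDominating (by omega), rfl⟩

/-- The case without inserted periods, in which the word need not start like a period. -/
theorem rainbowDominationNumber_le_of_word {L b : ℕ} (B : List (Column k))
    (h : B.length = L ∧ (B.map wt).sum = b ∧ 2 ≤ L ∧ IsMobiusWord B) :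
    rainbowDominationNumber (mobiusLadder L) k ≤ b := by
  obtain ⟨rfl, rfl, hL, hB⟩ := h
  exact (isLeast_rainbowDominationNumber _ _).2
    ⟨_, hB.isMobius.isRainbowDominating hL, by rw [rainbowWeight_toFun, sum_wt_getD]⟩

/-! ### The explicit periodic colouring -/

/-- The column of the period-six colouring at the indices congruent to `r`. -/
def periodic (k r : ℕ) : Column k :=
  (Finset.univ.filter fun c => (r = 1 ∧ 2 ≤ c.val) ∨ (r = 3 ∧ c.val = 0) ∨ (r = 5 ∧ c.val = 1),
    Finset.univ.filter fun c => (r = 0 ∧ c.val = 0) ∨ (r = 2 ∧ c.val = 1) ∨ (r = 4 ∧ 2 ≤ c.val))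

lemma mobiusColoring_eq_toFun (m k : ℕ) :
    mobiusColoring m k = toFun fun i => periodic k (i % 6) := by
  funext ⟨i, b⟩
  cases b <;> simp [mobiusColoring, toFun, periodic]

lemma dominated_periodic {k r : ℕ} (hk : 3 ≤ k) (hk' : k ≤ 5) (hr : r < 6) :
    Dominated (periodic k r) (periodic k ((r + 1) % 6)) (periodic k ((r + 2) % 6)) := by
  interval_cases k <;> interval_cases r <;> decide

lemma isMobius_periodic {m k : ℕ} (hm : m % 6 = 3) (hk : 3 ≤ k) (hk' : k ≤ 5) :
    IsMobius m fun i => periodic k (i % 6) := by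
  refine ⟨fun i _ => ?_, ?_, ?_⟩
  · have := dominated_periodic hk hk' (Nat.mod_lt i (by norm_num : 6 > 0))
    simpa [Nat.add_mod] using this
  · have e : (m - 1) % 6 = 2 := by omega
    simp only [e]
    interval_cases k <;> decide
  · have e : (m - 1) % 6 = 2 := by omega
    have e' : (m - 2) % 6 = 1 := by omega
    simp only [e, e']
    interval_cases k <;> decide

lemma rainbowWeight_mobiusColoring {m k : ℕ} (hm : m % 6 = 3) (hk : 3 ≤ k) (hk' : k ≤ 5) :
    rainbowWeight (mobiusColoring m k) = k * (m / 3) := by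
  rw [mobiusColoring_eq_toFun, rainbowWeight_toFun]
  have key : ∀ q, ∑ i ∈ Finset.range (6 * q + 3), (periodic k (i % 6)).wt = k * (2 * q + 1) := by
    intro q
    induction q with
    | zero => interval_cases k <;> decide
    | succ q ih =>
      have e : 6 * (q + 1) + 3 = 6 * q + 3 + 6 := by ring
      rw [e, Finset.sum_range_add, ih]
      have h6 : ∑ j ∈ Finset.range 6, (periodic k ((6 * q + 3 + j) % 6)).wt = 2 * k := by
        have : ∀ j, (6 * q + 3 + j) % 6 = (3 + j) % 6 := fun j => by omega
        simp only [this]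
        interval_cases k <;> decide
      rw [h6]
      ring
  have e : m = 6 * (m / 6) + 3 := by omega
  have e' : m / 3 = 2 * (m / 6) + 1 := by omega
  rw [e', ← key, ← e]

lemma rainbowDominationNumber_le_periodic {m k : ℕ} (hm : m % 6 = 3) (hk : 3 ≤ k) (hk' : k ≤ 5) :
    rainbowDominationNumber (mobiusLadder m) k ≤ k * (m / 3) := by
  rw [← rainbowWeight_mobiusColoring hm hk hk', mobiusColoring_eq_toFun]
  exact (isLeast_rainbowDominationNumber _ _).2
    ⟨_, (isMobius_periodic hm hk hk').isRainbowDominating (by omega), rfl⟩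

/-! ### Upper bounds -/

theorem rainbowDominationNumber_one_le {m : ℕ} (hm : 2 ≤ m) :
    rainbowDominationNumber (mobiusLadder m) 1 ≤
      (m + 1) / 2 + (if m % 4 = 0 then 1 else 0) := by
  have hr : m % 4 = 0 ∨ m % 4 = 1 ∨ m % 4 = 2 ∨ m % 4 = 3 := by omega
  rcases hr with h | h | h | h
  · have := rainbowDominationNumber_le_of_words (k := 1) (m := m) (L := 4) (b := 3)
      (n := 4) (w := 2) (q := (m - 4) / 4)
      [({0}, ∅), (∅, ∅), (∅, {0}), (∅, {0})]
      [({0}, ∅), (∅, ∅), (∅, {0}), (∅, ∅)] (by decide) (by omega)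
    split_ifs; omega
  · have := rainbowDominationNumber_le_of_words (k := 1) (m := m) (L := 5) (b := 3)
      (n := 4) (w := 2) (q := (m - 5) / 4)
      [({0}, ∅), (∅, ∅), (∅, {0}), (∅, ∅), ({0}, ∅)]
      [({0}, ∅), (∅, ∅), (∅, {0}), (∅, ∅)] (by decide) (by omega)
    split_ifs <;> omega
  · have := rainbowDominationNumber_le_of_words (k := 1) (m := m) (L := 2) (b := 1)
      (n := 4) (w := 2) (q := (m - 2) / 4)
      [({0}, ∅), (∅, ∅)]
      [({0}, ∅), (∅, ∅), (∅, {0}), (∅, ∅)] (by decide) (by omega)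
    split_ifs <;> omega
  · have := rainbowDominationNumber_le_of_words (k := 1) (m := m) (L := 3) (b := 2)
      (n := 4) (w := 2) (q := (m - 3) / 4)
      [({0}, ∅), (∅, ∅), (∅, {0})]
      [({0}, ∅), (∅, ∅), (∅, {0}), (∅, ∅)] (by decide) (by omega)
    split_ifs <;> omega

theorem rainbowDominationNumber_two_le {m : ℕ} (hm : 2 ≤ m) :
    rainbowDominationNumber (mobiusLadder m) 2 ≤
      m := by
  have hr : m % 2 = 0 ∨ m % 2 = 1 := by omega
  rcases hr with h | h
  · have := rainbowDominationNumber_le_of_words (k := 2) (m := m) (L := 2) (b := 2)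
      (n := 2) (w := 2) (q := (m - 2) / 2)
      [({0}, ∅), (∅, {1})]
      [({0}, ∅), (∅, {1})] (by decide) (by omega)
    omega
  · have := rainbowDominationNumber_le_of_words (k := 2) (m := m) (L := 3) (b := 3)
      (n := 2) (w := 2) (q := (m - 3) / 2)
      [({0}, ∅), (∅, {1}), ({0}, ∅)]
      [({0}, ∅), (∅, {1})] (by decide) (by omega)
    omega

/-- The period-six colouring with the three colour sets `{0}`, `{1}` and `A` in turn. -/
def period (k : ℕ) (A : Finset (Fin (k + 3))) : List (Column (k + 3)) :=
  [({0}, ∅), (∅, {1}), (A, ∅), (∅, {0}), ({1}, ∅), (∅, A)]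

/-- The words for `k ≥ 3` follow the period except near one place, where the defect enforced by the
residue of `m` is repaired. For `m = 2` the ladder is the complete graph on four vertices and is
treated separately. -/
theorem rainbowDominationNumber_three_le {m : ℕ} (hm : 2 ≤ m) :
    rainbowDominationNumber (mobiusLadder m) 3 ≤
      m + (if m % 6 = 3 then 0 else if m % 6 = 1 then 2 else 1) := by
  have hr : m % 6 = 0 ∨ m % 6 = 1 ∨ m % 6 = 2 ∨ m % 6 = 3 ∨ m % 6 = 4 ∨ m % 6 = 5 := by omega
  rcases hr with h | h | h | h | h | h
  · have := rainbowDominationNumber_le_of_words (k := 3) (m := m) (L := 6) (b := 7)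
      (n := 6) (w := 6) (q := (m - 6) / 6)
      [({0}, ∅), (∅, {1}), ({2}, {2}), ({0}, ∅), (∅, {1}), ({2}, ∅)]
      (period 0 {2}) (by decide) (by omega)
    split_ifs <;> omega
  · have := rainbowDominationNumber_le_of_words (k := 3) (m := m) (L := 7) (b := 9)
      (n := 6) (w := 6) (q := (m - 7) / 6)
      [({0}, ∅), (∅, {1}), ({0, 2}, ∅), (∅, {2}), ({1}, ∅), (∅, {0}), ({2}, {0})]
      (period 0 {2}) (by decide) (by omega)
    split_ifs <;> omega
  · rcases eq_or_ne m 2 with rfl | hm2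
    · exact rainbowDominationNumber_le_of_word (b := 3) [(∅, ∅), (∅, {0, 1, 2})] (by decide)
    · have := rainbowDominationNumber_le_of_words (k := 3) (m := m) (L := 8) (b := 9)
        (n := 6) (w := 6) (q := (m - 8) / 6)
        [({0}, ∅), (∅, {1}), ({2}, {0}), ({1}, ∅), (∅, {2}), ({0}, ∅), (∅, {1}), ({2}, ∅)]
        (period 0 {2}) (by decide) (by omega)
      split_ifs <;> omega
  · have := rainbowDominationNumber_le_periodic (k := 3) h (by norm_num) (by norm_num)
    split_ifs; omega
  · have := rainbowDominationNumber_le_of_words (k := 3) (m := m) (L := 4) (b := 5)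
      (n := 6) (w := 6) (q := (m - 4) / 6)
      [({0}, ∅), (∅, {1}), ({2}, ∅), ({2}, {0})]
      (period 0 {2}) (by decide) (by omega)
    split_ifs <;> omega
  · have := rainbowDominationNumber_le_of_words (k := 3) (m := m) (L := 5) (b := 6)
      (n := 6) (w := 6) (q := (m - 5) / 6)
      [({0}, ∅), (∅, {1}), ({2}, ∅), (∅, {0}), ({1, 2}, ∅)]
      (period 0 {2}) (by decide) (by omega)
    split_ifs <;> omega

theorem rainbowDominationNumber_four_le {m : ℕ} (hm : 2 ≤ m) :
    rainbowDominationNumber (mobiusLadder m) 4 ≤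
      (4 * m + 2) / 3 + (if m % 6 = 3 ∨ m % 6 = 4 then 0 else 1) := by
  have hr : m % 6 = 0 ∨ m % 6 = 1 ∨ m % 6 = 2 ∨ m % 6 = 3 ∨ m % 6 = 4 ∨ m % 6 = 5 := by omega
  rcases hr with h | h | h | h | h | h
  · have := rainbowDominationNumber_le_of_words (k := 4) (m := m) (L := 6) (b := 9)
      (n := 6) (w := 8) (q := (m - 6) / 6)
      [({0}, ∅), (∅, {1}), ({2, 3}, ∅), ({0}, {0}), (∅, {1}), ({2, 3}, ∅)]
      (period 1 {2, 3}) (by decide) (by omega)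
    split_ifs <;> omega
  · have := rainbowDominationNumber_le_of_words (k := 4) (m := m) (L := 7) (b := 11)
      (n := 6) (w := 8) (q := (m - 7) / 6)
      [({0}, ∅), (∅, {1}), ({2, 3}, ∅), (∅, {0}), ({1}, {0}), (∅, {0}), ({2, 3}, {0})]
      (period 1 {2, 3}) (by decide) (by omega)
    split_ifs <;> omega
  · rcases eq_or_ne m 2 with rfl | hm2
    · exact rainbowDominationNumber_le_of_word (b := 4) [(∅, ∅), (∅, {0, 1, 2, 3})] (by decide)
    · have := rainbowDominationNumber_le_of_words (k := 4) (m := m) (L := 8) (b := 12)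
        (n := 6) (w := 8) (q := (m - 8) / 6)
        [({0}, ∅), (∅, {1}), ({2, 3}, {0}), ({1}, ∅), (∅, {2, 3}), ({0}, ∅), (∅, {1}), ({2, 3}, ∅)]
        (period 1 {2, 3}) (by decide) (by omega)
      split_ifs <;> omega
  · have := rainbowDominationNumber_le_periodic (k := 4) h (by norm_num) (by norm_num)
    split_ifs <;> omega
  · have := rainbowDominationNumber_le_of_words (k := 4) (m := m) (L := 4) (b := 6)
      (n := 6) (w := 8) (q := (m - 4) / 6)
      [(∅, {1}), ({2, 3}, ∅), (∅, {0}), ({1}, {0})]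
      ((period 1 {2, 3}).rotate 1) (by decide) (by omega)
    split_ifs <;> omega
  · have := rainbowDominationNumber_le_of_words (k := 4) (m := m) (L := 5) (b := 8)
      (n := 6) (w := 8) (q := (m - 5) / 6)
      [({0}, ∅), (∅, {1}), ({2, 3}, ∅), (∅, {0}), ({1, 2, 3}, ∅)]
      (period 1 {2, 3}) (by decide) (by omega)
    split_ifs <;> omega

theorem rainbowDominationNumber_five_le {m : ℕ} (hm : 2 ≤ m) :
    rainbowDominationNumber (mobiusLadder m) 5 ≤
      (5 * m + 2) / 3 + (if m % 6 = 0 ∨ m % 6 = 1 then 1 else 0) := by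
  have hr : m % 6 = 0 ∨ m % 6 = 1 ∨ m % 6 = 2 ∨ m % 6 = 3 ∨ m % 6 = 4 ∨ m % 6 = 5 := by omega
  rcases hr with h | h | h | h | h | h
  · have := rainbowDominationNumber_le_of_words (k := 5) (m := m) (L := 6) (b := 11)
      (n := 6) (w := 10) (q := (m - 6) / 6)
      [({0}, ∅), (∅, {1}), ({2, 3, 4}, ∅), ({0}, {0}), (∅, {1}), ({2, 3, 4}, ∅)]
      (period 2 {2, 3, 4}) (by decide) (by omega)
    split_ifs <;> omega
  · have := rainbowDominationNumber_le_of_words (k := 5) (m := m) (L := 7) (b := 13)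
      (n := 6) (w := 10) (q := (m - 7) / 6)
      [({0}, ∅), (∅, {1}), ({2, 3, 4}, ∅), (∅, {0, 1}), ({0}, {0}), (∅, {1}), ({2, 3, 4}, ∅)]
      (period 2 {2, 3, 4}) (by decide) (by omega)
    split_ifs <;> omega
  · rcases eq_or_ne m 2 with rfl | hm2
    · exact rainbowDominationNumber_le_of_word (b := 4) [({0}, {0}), ({0}, {0})] (by decide)
    · have := rainbowDominationNumber_le_of_words (k := 5) (m := m) (L := 8) (b := 14)
        (n := 6) (w := 10) (q := (m - 8) / 6)
        [({0}, ∅), (∅, {1}), ({2, 3, 4}, ∅), (∅, {0}), ({1}, {0}), ({0}, {0}), (∅, {1}),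
          ({2, 3, 4}, ∅)]
        (period 2 {2, 3, 4}) (by decide) (by omega)
      split_ifs <;> omega
  · have := rainbowDominationNumber_le_periodic (k := 5) h (by norm_num) (by norm_num)
    split_ifs <;> omega
  · have := rainbowDominationNumber_le_of_words (k := 5) (m := m) (L := 4) (b := 7)
      (n := 6) (w := 10) (q := (m - 4) / 6)
      [(∅, {1}), ({2, 3, 4}, ∅), (∅, {0}), ({1}, {0})]
      ((period 2 {2, 3, 4}).rotate 1) (by decide) (by omega)
    split_ifs <;> omega
  · have := rainbowDominationNumber_le_of_words (k := 5) (m := m) (L := 5) (b := 9)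
      (n := 6) (w := 10) (q := (m - 5) / 6)
      [(∅, {1}), ({2, 3, 4}, ∅), (∅, {0}), ({1}, {0}), ({0}, {0})]
      ((period 2 {2, 3, 4}).rotate 1) (by decide) (by omega)
    split_ifs <;> omega

theorem rainbowDominationNumber_le_two_mul {m k : ℕ} (hk : 0 < k) :
    rainbowDominationNumber (mobiusLadder m) k ≤ 2 * m := by
  refine (isLeast_rainbowDominationNumber _ _).2 ⟨fun _ => {⟨0, hk⟩}, fun v hv => ?_, ?_⟩
  · simp at hv
  · simp [rainbowWeight, mul_comm]

end Column

/-! ### The rainbow domination numbers of the Möbius ladder -/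

lemma natCeil_natCast_div {d : ℕ} (hd : 0 < d) (n : ℕ) :
    ⌈(n : ℚ) / d⌉₊ = (n + d - 1) / d := by
  refine eq_of_forall_ge_iff fun c => ?_
  rw [← Nat.ceilDiv_eq_add_pred_div, ceilDiv_le_iff_le_mul hd, Nat.ceil_le,
    div_le_iff₀ (by exact_mod_cast hd), mul_comm d]
  exact_mod_cast Iff.rfl

theorem mainTheorem5 (m : ℕ) (hm : 2 ≤ m) :
    rainbowDominationNumber (mobiusLadder m) 1
        = ⌈(m : ℚ) / 2⌉₊ + (if m % 4 = 0 then 1 else 0) ∧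
    rainbowDominationNumber (mobiusLadder m) 2 = m ∧
    rainbowDominationNumber (mobiusLadder m) 3
        = m + (if m % 6 = 3 then 0 else if m % 6 = 1 then 2 else 1) ∧
    rainbowDominationNumber (mobiusLadder m) 4
        = ⌈4 * (m : ℚ) / 3⌉₊ + (if m % 6 = 3 ∨ m % 6 = 4 then 0 else 1) ∧
    rainbowDominationNumber (mobiusLadder m) 5
        = ⌈5 * (m : ℚ) / 3⌉₊ + (if m % 6 = 0 ∨ m % 6 = 1 then 1 else 0) ∧
    (∀ k : ℕ, 6 ≤ k → rainbowDominationNumber (mobiusLadder m) k = 2 * m) ∧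
    (m % 6 = 3 → ∀ k : ℕ, 3 ≤ k → k ≤ 6 →
      (rainbowDominationNumber (mobiusLadder m) k : ℚ) = (k : ℚ) * (m : ℚ) / 3) ∧
    (m % 6 = 3 → ∀ k : ℕ, 3 ≤ k → k ≤ 5 →
      IsRainbowDominating (mobiusLadder m) k (mobiusColoring m k) ∧
      rainbowWeight (mobiusColoring m k) = rainbowDominationNumber (mobiusLadder m) k) := by
  have : NeZero m := ⟨by omega⟩
  have e2 : ⌈(m : ℚ) / 2⌉₊ = (m + 1) / 2 := by
    exact_mod_cast natCeil_natCast_div two_pos m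
  have e4 : ⌈4 * (m : ℚ) / 3⌉₊ = (4 * m + 2) / 3 := by
    exact_mod_cast natCeil_natCast_div three_pos (4 * m)
  have e5 : ⌈5 * (m : ℚ) / 3⌉₊ = (5 * m + 2) / 3 := by
    exact_mod_cast natCeil_natCast_div three_pos (5 * m)
  have h1 : rainbowDominationNumber (mobiusLadder m) 1
      = (m + 1) / 2 + (if m % 4 = 0 then 1 else 0) :=
    (Column.rainbowDominationNumber_one_le hm).antisymm
      (by exact_mod_cast le_rainbowDominationNumber fun g hg => Circulant.le_weight_one hg)
  have h2 : rainbowDominationNumber (mobiusLadder m) 2 = m :=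
    (Column.rainbowDominationNumber_two_le hm).antisymm
      (by exact_mod_cast le_rainbowDominationNumber fun g hg => Circulant.le_weight_two hg)
  have h3 : rainbowDominationNumber (mobiusLadder m) 3
      = m + (if m % 6 = 3 then 0 else if m % 6 = 1 then 2 else 1) :=
    (Column.rainbowDominationNumber_three_le hm).antisymm
      (by exact_mod_cast le_rainbowDominationNumber fun g hg => Circulant.le_weight_three hg hm)
  have h4 : rainbowDominationNumber (mobiusLadder m) 4
      = (4 * m + 2) / 3 + (if m % 6 = 3 ∨ m % 6 = 4 then 0 else 1) :=
    (Column.rainbowDominationNumber_four_le hm).antisymm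
      (by exact_mod_cast le_rainbowDominationNumber fun g hg => Circulant.le_weight_four hg hm)
  have h5 : rainbowDominationNumber (mobiusLadder m) 5
      = (5 * m + 2) / 3 + (if m % 6 = 0 ∨ m % 6 = 1 then 1 else 0) :=
    (Column.rainbowDominationNumber_five_le hm).antisymm
      (by exact_mod_cast le_rainbowDominationNumber fun g hg => Circulant.le_weight_five hg hm)
  have h6 : ∀ k : ℕ, 6 ≤ k → rainbowDominationNumber (mobiusLadder m) k = 2 * m := fun k hk =>
    (Column.rainbowDominationNumber_le_two_mul (by omega)).antisymm
      (by exact_mod_cast le_rainbowDominationNumber fun g hg => Circulant.le_weight_of_six_le hk hg)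
  have h7 : m % 6 = 3 → ∀ k : ℕ, 3 ≤ k → k ≤ 6 →
      rainbowDominationNumber (mobiusLadder m) k = k * (m / 3) := by
    intro hm3 k hk hk'
    simp [hm3] at h3 h4 h5
    have h66 := h6 6 le_rfl
    interval_cases k
    · omega
    · omega
    · omega
    · omega
  refine ⟨by rw [h1, e2], h2, h3, by rw [h4, e4], by rw [h5, e5], h6, ?_, ?_⟩
  · intro hm3 k hk hk'
    have e : (m : ℚ) = 3 * (m / 3 : ℕ) := by
      have : m = 3 * (m / 3) := by omega
      exact_mod_cast this
    rw [h7 hm3 k hk hk', e]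
    push_cast
    ring
  · intro hm3 k hk hk'
    rw [h7 hm3 k hk (by omega)]
    refine ⟨?_, Column.rainbowWeight_mobiusColoring hm3 hk hk'⟩
    rw [Column.mobiusColoring_eq_toFun]
    exact (Column.isMobius_periodic hm3 hk hk').isRainbowDominating hm
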